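/- **Definitions.** "Regular cardinal" means infinite regular cardinal. For a set $X$ and a cardinal $\tau$, $[X]^{\tau}$ and $[X]^{<\tau}$ denote the sets of subsets of $X$ of size $\tau$ and of size $<\tau$, respectively. $H(\Theta)$ is the set of all sets whose transitive closure has size less than $\Theta$, regarded as an $\in$-structure. A set $M$ is *weakly closed* if for every regular cardinal $\tau$ and every $I\in[M]^{\tau}$ there is $J\in[I]^{\tau}$ with $[J]^{<\tau}\subseteq M$. A *continuous $\in$-chain* is a sequence $\langle M_\xi:\xi<\alpha\rangle$ of sets such that $M_\xi\subseteq M_\eta$ for $\xi<\eta<\alpha$, $\langle M_\xi:\xi\le\eta\rangle\in M_{\eta+1}$ whenever $\eta+1<\alpha$, and $M_\delta=\bigcup_{\xi<\delta}M_\xi$ for every limit ordinal $\delta<\alpha$. The *Closed Continuous $\in$-chain Axiom* (CECA) is the statement: for every uncountable cardinal $\lambda$, every regular cardinal $\Theta>\lambda$ and all $A,B\in H(\Theta)$ with $|A|=\lambda$ and $|B|<\lambda$, there is a continuous $\in$-chain $\langle M_\xi:\xi<\mathrm{cf}(\lambda)\rangle$ of weakly closed elementary submodels of $H(\Theta)$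 such that $|M_\xi|<\lambda$ for every $\xi<\mathrm{cf}(\lambda)$, $B\in M_0$, and $A\subseteq\bigcup_{\xi<\mathrm{cf}(\lambda)}M_\xi$. A sequence of sets $\langle A_\alpha\rangle_{\alpha<\kappa}$ is *point-$<\tau$* if $\bigcap_{\alpha\in I}A_\alpha=\emptyset$ for every $I\in[\kappa]^{\tau}$. **Theorem.** Assume CECA. Let $\sigma,\tau$ be regular infinite cardinals, let $\kappa$ be a cardinal, and let $\langle A_\alpha\rangle_{\alpha<\kappa}$ be a sequence of (not necessarily distinct) sets such that one of the following two conditions holds: 1. for every $I\in[\kappa]^{\tau}$ there is $J\in[I]^{<\tau}$ such that $\left|\bigcap_{\alpha\in J}A_\alpha\right|<\sigma$; 2. for every $I\in[\kappa]^{\tau}$ there is $J\in[I]^{<\tau}$ such that $\left|\bigcap_{\alpha\in J}A_\alpha\right|\le\sigma$, and for every $S\in\left[\bigcup_{\alpha<\kappa}A_\alpha\right]^{\sigma}$ we have $|\{\alpha<\kappa:S\subseteq A_\alpha\}|\le\sigma$. Then there is a sequence of sets $\langle A'_\alpha\rangle_{\alpha<\kappa}$ such that $|A'_\alpha|\le\sigma$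 for each $\alpha<\kappa$ and the sequence $\langle A_\alpha\setminus A'_\alpha\rangle_{\alpha<\kappa}$ is point-$<\tau$. -/

import Mathlib

open Cardinal

universe u

/-- The only symbol of the language of set theory: the binary relation symbol for membership. -/
inductive MembershipRel : ℕ → Type
  | mem : MembershipRel 2

/-- The first-order language of set theory. -/
def setLang : FirstOrder.Language.{0, 0} := ⟨fun _ => Empty, MembershipRel⟩

/-- A class of sets as an `∈`-structure. -/
instance setStructure (X : Set ZFSet.{u}) : setLang.Structure X where
  funMap := fun f _ => Empty.elim f
  RelMap := fun r => match r with
    | .mem => fun v => (v 0 : ZFSet.{u}) ∈ (v 1 : ZFSet.{u})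

/-- `H(Θ)`, the sets whose transitive closure has fewer than `Θ` elements, that is, the sets
included in some transitive set with fewer than `Θ` elements. -/
def hereditary (Θ : Cardinal.{u}) : Set ZFSet.{u} :=
  {x | ∃ t : ZFSet.{u}, t.IsTransitive ∧ x ⊆ t ∧ t.card < Θ}

/-- `M` is (the universe of) an elementary submodel of `(H(Θ), ∈)`. -/
def IsElementarySubmodel (Θ : Cardinal.{u}) (M : ZFSet.{u}) : Prop :=
  (∀ x ∈ M, x ∈ hereditary Θ) ∧
    ∃ S : setLang.ElementarySubstructure (hereditary Θ),
      ∀ x : hereditary Θ, x ∈ S ↔ (x : ZFSet.{u}) ∈ M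

/-- `M` is weakly `τ`-closed: every `I ∈ [M]^τ` has a subset `J ∈ [I]^τ` all of whose subsets of
size `< τ` are elements of `M`. -/
def IsWeaklyClosedAt (τ : Cardinal.{u}) (M : ZFSet.{u}) : Prop :=
  ∀ I : ZFSet.{u}, I ⊆ M → I.card = τ →
    ∃ J : ZFSet.{u}, J ⊆ I ∧ J.card = τ ∧
      ∀ K : ZFSet.{u}, K ⊆ J → K.card < τ → K ∈ M

/-- `M` is weakly closed: weakly `τ`-closed for every regular (infinite) cardinal `τ`. -/
def IsWeaklyClosed (M : ZFSet.{u}) : Prop :=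
  ∀ τ : Cardinal.{u}, τ.IsRegular → IsWeaklyClosedAt τ M

/-- The sequence `⟨M_ξ : ξ ≤ η⟩` as a set: the function `{(ξ, M_ξ) : ξ ≤ η}`, with Kuratowski
pairs and von Neumann ordinals. -/
noncomputable def initialSeq (M : Ordinal.{u} → ZFSet.{u}) (η : Ordinal.{u}) : ZFSet.{u} :=
  ZFSet.range (fun ξ : Set.Iic η => ZFSet.pair (ξ : Ordinal.{u}).toZFSet (M ξ))

/-- `⟨M_ξ : ξ < α⟩` is a continuous `∈`-chain. Only the values below `α` matter. -/
structure IsContinuousMemChain (α : Ordinal.{u}) (M : Ordinal.{u} → ZFSet.{u}) : Prop where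
  subset : ∀ ξ η, ξ < η → η < α → M ξ ⊆ M η
  seq_mem : ∀ η, η + 1 < α → initialSeq M η ∈ M (η + 1)
  continuous : ∀ δ, δ < α → Order.IsSuccLimit δ → ∀ x, x ∈ M δ ↔ ∃ ξ < δ, x ∈ M ξ

/-- `CECA(lam)`, the Closed Continuous `∈`-chain Axiom for `lam`. -/
def CECAAt (lam : Cardinal.{u}) : Prop :=
  ∀ Θ : Cardinal.{u}, Θ.IsRegular → lam < Θ →
    ∀ A B : ZFSet.{u}, A ∈ hereditary Θ → B ∈ hereditary Θ → A.card = lam → B.card < lam →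
      ∃ M : Ordinal.{u} → ZFSet.{u},
        IsContinuousMemChain lam.ord.cof.ord M ∧
        (∀ ξ < lam.ord.cof.ord,
          IsElementarySubmodel Θ (M ξ) ∧ IsWeaklyClosed (M ξ) ∧ (M ξ).card < lam) ∧
        B ∈ M 0 ∧
        ∀ a ∈ A, ∃ ξ < lam.ord.cof.ord, a ∈ M ξ

/-- The Closed Continuous `∈`-chain Axiom. -/
def CECA : Prop :=
  ∀ lam : Cardinal.{u}, ℵ₀ < lam → CECAAt lam

/-- The family `A` is point-`< τ`: the intersection over any `τ` many indices is empty. -/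
def IsPointLT {ι X : Type u} (τ : Cardinal.{u}) (A : ι → Set X) : Prop :=
  ∀ I : Set ι, #I = τ → ⋂ α ∈ I, A α = ∅

/-! Both conditions imply that τ many sets always include a subfamily of size < τ with intersection
of size ≤ σ, and that each S of size σ lies in at most σ or in fewer than τ of the sets. The proof
is by induction on the number κ of sets under this common hypothesis (`exists_isPointLT`). If κ ≤ σ,
a single weakly closed submodel M of size ≤ σ containing all the sets suffices: remove from each set
its points in M. Among τ many sets, weak closure finds a subfamily J ∈ M with intersection of size ≤
σ, and then that intersection is included in M. If κ > σ and κ ≥ τ, CECA gives a chain of smaller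
submodels (`exists_isPointLT_step`). A set not yet captured at a stage has at most σ points in the
stage: otherwise weak closure at σ⁺ puts a size-σ subset of it into the stage. So from a set first
captured at stage ξ + 1 one may remove its points in stage ξ, besides what the induction hypothesis
removes for the sets captured at ξ + 1. `exists_isPointLT_of_filtration` shows that this works. -/

open FirstOrder Language

/-! ### Closure properties of H(Θ). -/

section Hereditary

variable {Θ : Cardinal.{u}} {x y : ZFSet.{u}}

theorem hereditary_of_subset (h : x ⊆ y) (hy : y ∈ hereditary Θ) : x ∈ hereditary Θ := by
  obtain ⟨t, ht, hyt, htΘ⟩ := hy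
  exact ⟨t, ht, fun z hz => hyt (h hz), htΘ⟩

theorem hereditary_of_mem (h : x ∈ y) (hy : y ∈ hereditary Θ) : x ∈ hereditary Θ := by
  obtain ⟨t, ht, hyt, htΘ⟩ := hy
  exact ⟨t, ht, ht x (hyt h), htΘ⟩

theorem ZFSet.card_iUnion_le_sum_card {ι : Type u} (f : ι → ZFSet.{u}) :
    (ZFSet.iUnion f).card ≤ sum fun i => (f i).card := by
  simpa using ZFSet.lift_card_iUnion_le_sum_card (f := f)

theorem mem_hereditary_of_card_lt (hΘ : Θ.IsRegular) (hx : x.card < Θ)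
    (h : ∀ y ∈ x, y ∈ hereditary Θ) : x ∈ hereditary Θ := by
  choose! t ht hyt htΘ using h
  let f : Shrink.{u} x → ZFSet.{u} := fun i => t ((equivShrink x).symm i)
  refine ⟨x ∪ ZFSet.iUnion f, ?_, fun z hz => by simp [hz], ?_⟩
  · intro z hz w hw
    simp only [ZFSet.mem_union, ZFSet.mem_iUnion] at hz ⊢
    right
    rcases hz with hz | ⟨i, hz⟩
    · exact ⟨equivShrink x ⟨z, hz⟩, by simpa [f] using hyt z hz hw⟩
    · exact ⟨i, ht _ ((equivShrink x).symm i).2 z hz hw⟩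
  · refine ZFSet.card_union_le.trans_lt (add_lt_of_lt hΘ.aleph0_le hx ?_)
    exact (ZFSet.card_iUnion_le_sum_card f).trans_lt
      (sum_lt_of_isRegular hΘ hx fun i => htΘ _ ((equivShrink x).symm i).2)

theorem exists_isRegular_mem_hereditary (x : ZFSet.{u}) (c : Cardinal.{u}) :
    ∃ Θ : Cardinal.{u}, Θ.IsRegular ∧ c < Θ ∧ x ∈ hereditary Θ := by
  let m := max ℵ₀ (max c (ZFSet.vonNeumann x.rank).card)
  refine ⟨Order.succ m, isRegular_succ (le_max_left _ _), Order.lt_succ_of_le ?_,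
    _, ZFSet.isTransitive_vonNeumann _, ZFSet.subset_vonNeumann_self x, Order.lt_succ_of_le ?_⟩
  · exact (le_max_left _ _).trans (le_max_right _ _)
  · exact (le_max_right _ _).trans (le_max_right _ _)

end Hereditary

/-! ### Formulas and definability in elementary submodels. -/

section Elementary

/-- The membership symbol. -/
def memRel : setLang.Relations 2 := MembershipRel.mem

/-- The atomic formula expressing `t₁ ∈ t₂`. -/
def memFormula {α : Type} {n : ℕ} (t₁ t₂ : setLang.Term (α ⊕ Fin n)) :
    setLang.BoundedFormula α n :=
  memRel.boundedFormula₂ t₁ t₂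

/-- A free variable of a formula. -/
def freeVar {α : Type} (n : ℕ) (i : α) : setLang.Term (α ⊕ Fin n) := Term.var (Sum.inl i)

/-- A bound variable of a formula. -/
def boundVar {α : Type} {n : ℕ} (i : Fin n) : setLang.Term (α ⊕ Fin n) := Term.var (Sum.inr i)

variable {α : Type} {n : ℕ} {X : Set ZFSet.{u}} (v : α → X) (xs : Fin n → X)

@[simp] theorem realize_memFormula (t₁ t₂ : setLang.Term (α ⊕ Fin n)) :
    (memFormula t₁ t₂).Realize v xs ↔
      (t₁.realize (Sum.elim v xs)).1 ∈ (t₂.realize (Sum.elim v xs)).1 := by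
  unfold memFormula
  rw [BoundedFormula.realize_rel₂]
  rfl

@[simp] theorem realize_freeVar (i : α) : (freeVar n i).realize (Sum.elim v xs) = v i := rfl

@[simp] theorem realize_boundVar (i : Fin n) :
    (boundVar (α := α) i).realize (Sum.elim v xs) = xs i := rfl

/-- The only form in which elementarity is used: an existential statement with parameters in M has a
witness in M. -/
theorem IsElementarySubmodel.exists_mem_of_realize {Θ : Cardinal.{u}} {M : ZFSet.{u}}
    (hM : IsElementarySubmodel Θ M) (φ : setLang.BoundedFormula α 1) (v : α → hereditary Θ)
    (hv : ∀ i, (v i : ZFSet.{u}) ∈ M) (h : ∃ a : hereditary Θ, φ.Realize v (fun _ => a)) :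
    ∃ a : hereditary Θ, (a : ZFSet.{u}) ∈ M ∧ φ.Realize v (fun _ => a) := by
  obtain ⟨-, S, hS⟩ := hM
  let w : α → S := fun i => ⟨v i, (hS _).2 (hv i)⟩
  have snoc_eq : ∀ {Y : Type (u + 1)} (d : Fin 0 → Y) (a : Y),
      (Fin.snoc d a : Fin 1 → Y) = fun _ => a := by
    intro Y d a
    funext i
    simp [Fin.snoc]
  have key := (S.subtype.map_boundedFormula φ.ex w default).1
  simp only [BoundedFormula.realize_ex, snoc_eq] at key
  obtain ⟨a, ha⟩ := key h
  refine ⟨a, (hS _).1 a.2, ?_⟩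
  exact (S.subtype.map_boundedFormula φ w (fun _ => a)).2 ha

end Elementary

namespace IsElementarySubmodel

variable {Θ : Cardinal.{u}} {M : ZFSet.{u}}

/-- `M` contains the subsets of its elements that are definable with parameters in `M`. The bound
variable `1` of the formula is the one that is separated by, and `0` is not to be used. -/
theorem sep_mem (hM : IsElementarySubmodel Θ M) {α : Type} (v : α → hereditary Θ)
    (hv : ∀ i, (v i : ZFSet.{u}) ∈ M) (i : α) (φ : setLang.BoundedFormula α 2)
    (p : ZFSet.{u} → Prop)
    (hφ : ∀ a y : hereditary Θ, φ.Realize v (Fin.snoc (fun _ : Fin 1 => a) y) ↔ p y) :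
    (v i : ZFSet.{u}).sep p ∈ M := by
  let χ : setLang.BoundedFormula α 1 :=
    BoundedFormula.all ((memFormula (boundVar 1) (boundVar 0)).iff
      (memFormula (boundVar 1) (freeVar _ i) ⊓ φ))
  have hχ : ∀ a : hereditary Θ, χ.Realize v (fun _ => a) ↔
      (a : ZFSet.{u}) = (v i : ZFSet.{u}).sep p := by
    intro a
    simp only [χ, BoundedFormula.realize_all, BoundedFormula.realize_iff,
      BoundedFormula.realize_inf, realize_memFormula,
      realize_boundVar, realize_freeVar, hφ]
    simp only [Fin.snoc, Subtype.forall]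
    constructor
    · intro h
      ext y
      rw [ZFSet.mem_sep]
      exact ⟨fun hy => (h y (hereditary_of_mem hy a.2)).1 hy,
        fun hy => (h y (hereditary_of_mem hy.1 (v i).2)).2 hy⟩
    · intro h y hy
      simpa using ZFSet.ext_iff.1 h y
  obtain ⟨a, haM, ha⟩ := hM.exists_mem_of_realize χ v hv
    ⟨⟨_, hereditary_of_subset ZFSet.sep_subset (v i).2⟩, (hχ _).2 rfl⟩
  exact (hχ a).1 ha ▸ haM

/-- With F the set of codes of points and J a set of codes of members of the family, this puts the
intersection of the subfamily into M. -/
theorem sep_forall_mem_mem (hM : IsElementarySubmodel Θ M) {F J : ZFSet.{u}} (hF : F ∈ M)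
    (hJ : J ∈ M) : F.sep (fun y => ∀ a ∈ J, y ∈ a) ∈ M := by
  refine hM.sep_mem (![⟨J, hM.1 J hJ⟩, ⟨F, hM.1 F hF⟩] : Fin 2 → hereditary Θ)
    (by intro i; fin_cases i <;> simp [hF, hJ]) 1
    (BoundedFormula.all ((memFormula (boundVar 2) (freeVar _ 0)).imp
      (memFormula (boundVar 1) (boundVar 2)))) _ fun a y => ?_
  simp only [BoundedFormula.realize_all, BoundedFormula.realize_imp, realize_memFormula,
    realize_boundVar, realize_freeVar, Subtype.forall]
  simp only [Fin.snoc]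
  exact ⟨fun h b hb => h b (hereditary_of_mem hb (hM.1 J hJ)) hb, fun h b _ hb => h b hb⟩

theorem sep_subset_mem (hM : IsElementarySubmodel Θ M) {C S : ZFSet.{u}} (hC : C ∈ M)
    (hS : S ∈ M) : C.sep (fun a => S ⊆ a) ∈ M := by
  refine hM.sep_mem (![⟨S, hM.1 S hS⟩, ⟨C, hM.1 C hC⟩] : Fin 2 → hereditary Θ)
    (by intro i; fin_cases i <;> simp [hC, hS]) 1
    (BoundedFormula.all ((memFormula (boundVar 2) (freeVar _ 0)).imp
      (memFormula (boundVar 2) (boundVar 1)))) _ fun a y => ?_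
  simp only [BoundedFormula.realize_all, BoundedFormula.realize_imp, realize_memFormula,
    realize_boundVar, realize_freeVar, Subtype.forall]
  simp only [Fin.snoc]
  exact ⟨fun h b hb => h b (hereditary_of_mem hb (hM.1 S hS)) hb, fun h b _ hb => h hb⟩

/-- If `M` contains `Z` as an element and a subset, then it includes its elements that have at most
as many elements as `Z`. -/
theorem subset_of_card_le (hM : IsElementarySubmodel Θ M) (hΘ : Θ.IsRegular) {Z D : ZFSet.{u}}
    (hZ : Z ∈ M) (hZM : Z ⊆ M) (hD : D ∈ M) (hDZ : D.card ≤ Z.card) : D ⊆ M := by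
  have hZH := hM.1 Z hZ
  have hDH := hM.1 D hD
  obtain ⟨f⟩ : Nonempty (Shrink.{u} D ↪ Shrink.{u} Z) := hDZ
  let f' : {d // d ∈ D} → ZFSet.{u} := fun d => ((equivShrink Z).symm (f (equivShrink D d))).1
  have hf'Z : ∀ d, f' d ∈ Z := fun d => ((equivShrink Z).symm (f (equivShrink D d))).2
  have hf' : Function.Injective f' := fun a b h => by
    simpa [f', Subtype.val_inj] using h
  let s := {d : {d // d ∈ D} // d.1 ∉ Z}
  -- The injection D → Z is coded by unordered pairs, restricted to D \ Z: the component in Z is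
  -- then recognizable, and no ordered pairs need to be formalized.
  let pr : s → ZFSet.{u} := fun d => {f' d.1, d.1.1}
  let g : ZFSet.{u} := ZFSet.range pr
  have hpr : ∀ d : s, pr d ∈ hereditary Θ := fun d => by
    refine mem_hereditary_of_card_lt hΘ ?_ ?_
    · exact ZFSet.card_insert_le.trans_lt (by
        rw [ZFSet.card_singleton]
        exact_mod_cast hΘ.nat_lt 2)
    · intro y hy
      rcases ZFSet.mem_pair.1 hy with rfl | rfl
      · exact hereditary_of_mem (hf'Z _) hZH
      · exact hereditary_of_mem d.1.2 hDH
  have hg : g ∈ hereditary Θ := by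
    refine mem_hereditary_of_card_lt hΘ ?_ ?_
    · have h₁ : g.card ≤ D.card := by
        rw [← Cardinal.lift_le.{u + 1}, ← ZFSet.cardinalMk_coe_sort, ← ZFSet.cardinalMk_coe_sort]
        refine (mk_le_of_surjective (f := fun d : s => (⟨pr d, ZFSet.mem_range_self d⟩ : g))
          ?_).trans (mk_subtype_le _)
        rintro ⟨y, hy⟩
        obtain ⟨d, rfl⟩ := ZFSet.mem_range.1 hy
        exact ⟨d, rfl⟩
      obtain ⟨t, -, hDt, ht⟩ := hDH
      exact (h₁.trans (ZFSet.card_mono hDt)).trans_lt ht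
    · intro y hy
      obtain ⟨d, rfl⟩ := ZFSet.mem_range.1 hy
      exact hpr d
  have hfun : ∀ d : s, ∀ z ∈ Z, z ∈ pr d → z = f' d.1 := fun d z hz hzp =>
    (ZFSet.mem_pair.1 hzp).resolve_right fun h => d.2 (h ▸ hz)
  have hval : ∀ d : s, ∀ e, e ∉ Z → e ∈ pr d → e = d.1.1 := fun d e he hep =>
    (ZFSet.mem_pair.1 hep).resolve_left fun h => he (h ▸ hf'Z _)
  -- φ(a): each d ∈ D \ Z shares an element of a with some z ∈ Z, and each z ∈ Z has at most one
  -- such partner outside Z.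
  let φ : setLang.BoundedFormula (Fin 2) 1 :=
    (BoundedFormula.all ((memFormula (boundVar 1) (freeVar _ 1)).imp
      ((memFormula (boundVar 1) (freeVar _ 0)).not.imp
        (BoundedFormula.ex (memFormula (boundVar 2) (freeVar _ 0) ⊓
          BoundedFormula.ex (memFormula (boundVar 3) (boundVar 0) ⊓
            (memFormula (boundVar 2) (boundVar 3) ⊓ memFormula (boundVar 1) (boundVar 3)))))))) ⊓
    (BoundedFormula.all ((memFormula (boundVar 1) (freeVar _ 0)).imp
      (BoundedFormula.all ((memFormula (boundVar 2) (boundVar 0)).imp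
        (BoundedFormula.all ((memFormula (boundVar 3) (boundVar 0)).imp
          ((memFormula (boundVar 1) (boundVar 2)).imp ((memFormula (boundVar 1) (boundVar 3)).imp
          (BoundedFormula.all ((memFormula (boundVar 4) (freeVar _ 0)).not.imp
            (BoundedFormula.all ((memFormula (boundVar 5) (freeVar _ 0)).not.imp
              ((memFormula (boundVar 4) (boundVar 2)).imp
              ((memFormula (boundVar 5) (boundVar 3)).imp
                (Term.bdEqual (boundVar 4) (boundVar 5))))))))))))))))
  let v : Fin 2 → hereditary Θ := ![⟨Z, hZH⟩, ⟨D, hDH⟩]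
  have hv : ∀ i, (v i : ZFSet.{u}) ∈ M := by intro i; fin_cases i <;> simp [v, hZ, hD]
  have hφ : ∀ a : hereditary Θ, φ.Realize v (fun _ => a) ↔
      (∀ d : hereditary Θ, d.1 ∈ D → d.1 ∉ Z → ∃ z : hereditary Θ, z.1 ∈ Z ∧
        ∃ p : hereditary Θ, p.1 ∈ a.1 ∧ z.1 ∈ p.1 ∧ d.1 ∈ p.1) ∧
      ∀ z : hereditary Θ, z.1 ∈ Z → ∀ p : hereditary Θ, p.1 ∈ a.1 →
        ∀ q : hereditary Θ, q.1 ∈ a.1 → z.1 ∈ p.1 → z.1 ∈ q.1 →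
          ∀ d : hereditary Θ, d.1 ∉ Z → ∀ e : hereditary Θ, e.1 ∉ Z →
            d.1 ∈ p.1 → e.1 ∈ q.1 → d = e := by
    intro a
    simp only [φ, BoundedFormula.realize_all, BoundedFormula.realize_ex, BoundedFormula.realize_inf,
      BoundedFormula.realize_imp, BoundedFormula.realize_not, realize_memFormula,
      BoundedFormula.realize_bdEqual, realize_boundVar, realize_freeVar, v]
    exact Iff.rfl
  have hgφ : φ.Realize v (fun _ => ⟨g, hg⟩) := by
    refine (hφ _).2 ⟨?_, ?_⟩
    · intro d hd hdZ
      refine ⟨⟨f' ⟨d, hd⟩, hereditary_of_mem (hf'Z _) hZH⟩, hf'Z _, ⟨pr ⟨⟨d, hd⟩, hdZ⟩, hpr _⟩,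
        ZFSet.mem_range_self _, ?_, ?_⟩ <;> simp [pr]
    · intro z hz p hp q hq hzp hzq d hdZ e heZ hdp heq
      obtain ⟨d', hd'⟩ := ZFSet.mem_range.1 hp
      obtain ⟨e', he'⟩ := ZFSet.mem_range.1 hq
      rw [← hd'] at hzp hdp
      rw [← he'] at hzq heq
      have h₁ : d' = e' := Subtype.ext (hf' ((hfun d' z hz hzp).symm.trans (hfun e' z hz hzq)))
      subst h₁
      exact Subtype.ext ((hval d' d hdZ hdp).trans (hval d' e heZ heq).symm)
  obtain ⟨a, haM, ha⟩ := hM.exists_mem_of_realize φ v hv ⟨⟨g, hg⟩, hgφ⟩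
  obtain ⟨hsurj, huniq⟩ := (hφ a).1 ha
  intro d hd
  by_cases hdZ : d ∈ Z
  · exact hZM hdZ
  obtain ⟨z, hz, p, hp, hzp, hdp⟩ := hsurj ⟨d, hereditary_of_mem hd hDH⟩ hd hdZ
  -- ψ defines d from a, Z and z, which are all in M, as the unique partner of z outside Z.
  let ψ : setLang.BoundedFormula (Fin 3) 1 :=
    (memFormula (boundVar 0) (freeVar _ 1)).not ⊓
      BoundedFormula.ex (memFormula (boundVar 1) (freeVar _ 0) ⊓
        (memFormula (freeVar _ 2) (boundVar 1) ⊓ memFormula (boundVar 0) (boundVar 1)))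
  let w : Fin 3 → hereditary Θ := ![a, ⟨Z, hZH⟩, z]
  have hw : ∀ i, (w i : ZFSet.{u}) ∈ M := by
    intro i; fin_cases i <;> simp [w, hZ, haM, hZM hz]
  have hψ : ∀ b : hereditary Θ, ψ.Realize w (fun _ => b) ↔
      b.1 ∉ Z ∧ ∃ p : hereditary Θ, p.1 ∈ a.1 ∧ z.1 ∈ p.1 ∧ b.1 ∈ p.1 := by
    intro b
    simp only [ψ, BoundedFormula.realize_ex, BoundedFormula.realize_inf,
      BoundedFormula.realize_not, realize_memFormula, realize_boundVar, realize_freeVar, w]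
    exact Iff.rfl
  obtain ⟨b, hbM, hb⟩ := hM.exists_mem_of_realize ψ w hw
    ⟨⟨d, hereditary_of_mem hd hDH⟩, (hψ _).2 ⟨hdZ, p, hp, hzp, hdp⟩⟩
  obtain ⟨hbZ, q, hq, hzq, hbq⟩ := (hψ b).1 hb
  rw [← huniq z hz p hp q hq hzp hzq ⟨d, _⟩ hdZ b hbZ hdp hbq] at hbM
  exact hbM

end IsElementarySubmodel

/-! ### Gluing solutions along a filtration. -/

section Filtration

variable {ι X : Type u}

/-- `P ξ` are the indices and `Q ξ` the points captured at stage ξ. The rank `r α` of an index is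
the first stage capturing it, never a limit by `hPlim`, so the points of `A α` in stages before `r
α` number at most σ by `hsmall`. -/
theorem exists_isPointLT_of_filtration {σ τ : Cardinal.{u}} (hτ : ℵ₀ ≤ τ) (A : ι → Set X)
    {Λ : Ordinal.{u}} (P : Ordinal.{u} → Set ι)
    (Q : Ordinal.{u} → Set X)
    (hQ : ∀ ξ η, ξ ≤ η → η < Λ → Q ξ ⊆ Q η)
    (hP : ∀ α, ∃ ξ < Λ, α ∈ P ξ)
    (hPlim : ∀ δ < Λ, Order.IsSuccLimit δ → ∀ α ∈ P δ, ∃ η < δ, α ∈ P η)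
    (hblock : ∀ ξ < Λ, ∃ A' : ι → Set X, (∀ α, #(A' α) ≤ σ) ∧
      ∀ I ⊆ P ξ, #I = τ → ⋂ α ∈ I, A α \ A' α = ∅)
    (hsmall : ∀ ξ < Λ, ∀ α ∉ P ξ, #(A α ∩ Q ξ : Set X) ≤ σ)
    (hlim : ∀ δ ≤ Λ, Order.IsSuccLimit δ → ∀ I ⊆ {α | ∃ η < δ, α ∈ P η}, #I = τ →
      ∀ x, (∀ α ∈ I, x ∈ A α) → ∃ η < δ, x ∈ Q η)
    (hσ : ℵ₀ ≤ σ) :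
    ∃ A' : ι → Set X, (∀ α, #(A' α) ≤ σ) ∧ IsPointLT τ (fun α => A α \ A' α) := by
  choose! A₀ hA₀ hA₀τ using hblock
  let r : ι → Ordinal.{u} := fun α => sInf {ξ | ξ < Λ ∧ α ∈ P ξ}
  have hr : ∀ α, r α < Λ ∧ α ∈ P (r α) := fun α => csInf_mem (hP α)
  have hrmin : ∀ α η, η < r α → α ∉ P η := fun α η hη hα =>
    notMem_of_lt_csInf' hη ⟨hη.trans (hr α).1, hα⟩
  have hfiber : ∀ η < Λ, ∀ I : Set ι, (∀ α ∈ I, r α = η) → ∀ x, (∀ α ∈ I, x ∈ A α \ A₀ (r α) α) →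
      #I < τ := by
    intro η hη I hI x hx
    by_contra! h
    obtain ⟨I', hI', hI'τ⟩ := le_mk_iff_exists_subset.1 h
    have := hA₀τ η hη I' (fun α hα => hI α (hI' hα) ▸ (hr α).2) hI'τ
    have hx' : x ∈ ⋂ α ∈ I', A α \ A₀ η α := by
      simp only [Set.mem_iInter]
      intro α hα
      have := hx α (hI' hα)
      rwa [hI α (hI' hα)] at this
    rw [this] at hx'
    exact hx'
  refine ⟨fun α => A₀ (r α) α ∪ (A α ∩ {x | ∃ η < r α, x ∈ Q η}), fun α => ?_, ?_⟩
  · refine (mk_union_le _ _).trans (add_le_of_le hσ (hA₀ _ (hr α).1 α) ?_)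
    rcases Ordinal.zero_or_succ_or_isSuccLimit (r α) with h | ⟨η, h⟩ | h
    · simp [h]
    · have hη : η < r α := h ▸ Order.lt_succ η
      refine (mk_le_mk_of_subset ?_).trans (hsmall η (hη.trans (hr α).1) α (hrmin α η hη))
      rintro x ⟨hx, ξ, hξ, hxξ⟩
      refine ⟨hx, hQ ξ η (Order.lt_succ_iff.1 (by rw [← h] at hξ; exact hξ)) (hη.trans (hr α).1) hxξ⟩
    · obtain ⟨η, hη, hα⟩ := hPlim _ (hr α).1 h α (hr α).2
      exact absurd hα (hrmin α η hη)
  · intro I hIτ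
    rw [Set.eq_empty_iff_forall_notMem]
    intro x hx
    simp only [Set.mem_iInter] at hx
    have hxA : ∀ α ∈ I, x ∈ A α := fun α hα => (hx α hα).1
    have hxA₀ : ∀ α ∈ I, x ∈ A α \ A₀ (r α) α := fun α hα =>
      ⟨(hx α hα).1, fun h => (hx α hα).2 (Or.inl h)⟩
    have hxQ : ∀ α ∈ I, ∀ η < r α, x ∉ Q η := fun α hα η hη h =>
      (hx α hα).2 (Or.inr ⟨(hx α hα).1, η, hη, h⟩)
    -- The least δ below which τ many indices of I have their rank is a limit: at a successor η + 1,
    -- τ many would have rank η, against `hfiber`. Then `hlim` puts x into an early `Q η`, while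
    -- some index of rank above η has lost its points in `Q η`.
    let D : Set Ordinal.{u} := {δ | τ ≤ #{α | α ∈ I ∧ r α < δ}}
    have hΛD : Λ ∈ D := by
      have : {α | α ∈ I ∧ r α < Λ} = I := by
        ext α
        simp [(hr α).1]
      simp [D, this, hIτ]
    have hδD : sInf D ∈ D := csInf_mem ⟨Λ, hΛD⟩
    have hδΛ : sInf D ≤ Λ := csInf_le' hΛD
    have hδmin : ∀ η < sInf D, #{α | α ∈ I ∧ r α < η} < τ := fun η hη =>
      not_le.1 (show ¬ τ ≤ _ from notMem_of_lt_csInf' (s := D) hη)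
    generalize sInf D = δ at hδD hδΛ hδmin
    have hδlim : Order.IsSuccLimit δ := by
      rcases Ordinal.zero_or_succ_or_isSuccLimit δ with h | ⟨η, h⟩ | h
      · subst h
        simp [D] at hδD
        exact absurd hτ (by simp [hδD, aleph0_ne_zero])
      · have hη : η < δ := h ▸ Order.lt_succ η
        have h₁ := hfiber η (hη.trans_le hδΛ) {α | α ∈ I ∧ r α = η} (fun α hα => hα.2) x
          (fun α hα => hxA₀ α hα.1)
        have h₂ := add_lt_of_lt hτ (hδmin η hη) h₁
        refine absurd hδD (not_le.2 (lt_of_le_of_lt ?_ h₂))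
        refine (mk_le_mk_of_subset ?_).trans (mk_union_le _ _)
        rintro α ⟨hα, hαδ⟩
        rw [← h] at hαδ
        rcases (Order.lt_succ_iff.1 hαδ).lt_or_eq with h | h
        · exact Or.inl ⟨hα, h⟩
        · exact Or.inr ⟨hα, h⟩
      · exact h
    obtain ⟨I', hI', hI'τ⟩ := le_mk_iff_exists_subset.1 hδD
    obtain ⟨η, hη, hxη⟩ := hlim δ hδΛ hδlim I' (fun α hα => ⟨r α, (hI' hα).2, (hr α).2⟩) hI'τ x
      (fun α hα => hxA α (hI' hα).1)
    have : ∃ α ∈ I', η < r α := by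
      by_contra! h
      refine absurd (hδmin (Order.succ η) (hδlim.succ_lt hη)) (not_lt.2 ?_)
      rw [← hI'τ]
      exact mk_le_mk_of_subset fun α hα => ⟨(hI' hα).1, Order.lt_succ_iff.2 (h α hα)⟩
    obtain ⟨α, hα, hηα⟩ := this
    exact hxQ α (hI' hα).1 η hηα hxη

end Filtration

/-! ### Coding a family of sets in `ZFSet`. -/

section Coding

variable {T : Type u}

/-- The image of a set under a map to `ZFSet`, as an element of `ZFSet`. -/
noncomputable def codeSet (c : T → ZFSet.{u}) (J : Set T) : ZFSet.{u} :=
  ZFSet.range fun j : J => c j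

@[simp] theorem mem_codeSet {c : T → ZFSet.{u}} {J : Set T} {y : ZFSet.{u}} :
    y ∈ codeSet c J ↔ ∃ j ∈ J, c j = y := by
  simp [codeSet]

theorem apply_mem_codeSet {c : T → ZFSet.{u}} (hc : Function.Injective c) {J : Set T} {t : T} :
    c t ∈ codeSet c J ↔ t ∈ J := by
  simp [hc.eq_iff]

theorem card_codeSet {c : T → ZFSet.{u}} (hc : Function.Injective c) (J : Set T) :
    (codeSet c J).card = #J := by
  rw [← Cardinal.lift_inj.{u, u + 1}, ← ZFSet.cardinalMk_coe_sort]
  have h : (codeSet c J : Set ZFSet.{u}) = c '' J := by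
    ext y
    simp
  have := mk_image_eq_lift c J hc
  rw [← h, Cardinal.lift_umax.{u, u + 1}] at this
  rw [← this]
  exact (Cardinal.lift_id'.{u, u + 1} _).symm

theorem codeSet_setOf_mem {c : T → ZFSet.{u}} {K : ZFSet.{u}}
    (hK : K ⊆ codeSet c Set.univ) : codeSet c {t | c t ∈ K} = K := by
  ext y
  rw [mem_codeSet]
  constructor
  · rintro ⟨t, ht, rfl⟩
    exact ht
  · intro hy
    obtain ⟨t, -, rfl⟩ := mem_codeSet.1 (hK hy)
    exact ⟨t, hy, rfl⟩

theorem mk_setOf_mem {c : T → ZFSet.{u}} (hc : Function.Injective c) {K : ZFSet.{u}}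
    (hK : K ⊆ codeSet c Set.univ) : #{t | c t ∈ K} = K.card := by
  rw [← card_codeSet hc, codeSet_setOf_mem hK]

theorem mk_setOf_mem_le {c : T → ZFSet.{u}} (hc : Function.Injective c) (K : ZFSet.{u}) :
    #{t | c t ∈ K} ≤ K.card := by
  rw [← card_codeSet hc]
  refine ZFSet.card_mono fun y hy => ?_
  obtain ⟨t, ht, rfl⟩ := mem_codeSet.1 hy
  exact ht

theorem codeSet_subset_codeSet (c : T → ZFSet.{u}) {J K : Set T} (h : J ⊆ K) :
    codeSet c J ⊆ codeSet c K := fun y hy => by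
  obtain ⟨t, ht, rfl⟩ := mem_codeSet.1 hy
  exact mem_codeSet.2 ⟨t, h ht, rfl⟩

theorem exists_injective_zfset (T : Type u) : ∃ c : T → ZFSet.{u}, Function.Injective c := by
  obtain ⟨e⟩ := nonempty_embedding_to_cardinal (α := T)
  exact ⟨fun t => (e t).ord.toZFSet,
    Ordinal.toZFSet_injective.comp (Cardinal.ord_injective.comp e.injective)⟩

/-- The code of `A α` gets an extra element, which codes no point, so that repeated sets in the
family have distinct codes. -/
theorem exists_coding {ι X : Type u} (A : ι → Set X) :
    ∃ (cX : X → ZFSet.{u}) (cι : ι → ZFSet.{u}), Function.Injective cX ∧ Function.Injective cι ∧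
      ∀ x α, cX x ∈ cι α ↔ x ∈ A α := by
  obtain ⟨e, he⟩ := exists_injective_zfset (X ⊕ ι)
  refine ⟨fun x => e (Sum.inl x),
    fun α => insert (e (Sum.inr α)) (codeSet (fun x => e (Sum.inl x)) (A α)),
    he.comp Sum.inl_injective, fun α β h => ?_, fun x α => ?_⟩
  · have : e (Sum.inr α) ∈ insert (e (Sum.inr β)) (codeSet (fun x => e (Sum.inl x)) (A β)) :=
      Eq.subst (motive := fun y => e (Sum.inr α) ∈ y) h (ZFSet.mem_insert _ _)
    simpa [he.eq_iff] using this
  · simp [he.eq_iff]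

end Coding

/-! ### Submodels obtained from CECA. -/

section Submodels

theorem IsContinuousMemChain.mono {Λ : Ordinal.{u}} {M : Ordinal.{u} → ZFSet.{u}}
    (hM : IsContinuousMemChain Λ M) {ξ η : Ordinal.{u}} (h : ξ ≤ η) (hη : η < Λ) : M ξ ⊆ M η := by
  rcases h.lt_or_eq with h | rfl
  · exact hM.subset ξ η h hη
  · exact fun _ => id

theorem IsContinuousMemChain.exists_subset {Λ : Ordinal.{u}} {M : Ordinal.{u} → ZFSet.{u}}
    (hM : IsContinuousMemChain Λ M) {Z : ZFSet.{u}} (hZ : Z.card < Λ.cof)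
    (hZM : ∀ z ∈ Z, ∃ ξ < Λ, z ∈ M ξ) : ∃ ξ < Λ, Z ⊆ M ξ := by
  choose! f hf hzf using hZM
  let g : Shrink.{u} Z → Ordinal.{u} := fun i => f ((equivShrink Z).symm i)
  have hg : iSup g < Λ := Ordinal.iSup_lt_of_lt_cof hZ fun i => hf _ ((equivShrink Z).symm i).2
  refine ⟨iSup g, hg, fun z hz => hM.mono ?_ hg (hzf z hz)⟩
  have := Ordinal.le_iSup g (equivShrink Z ⟨z, hz⟩)
  simpa [g] using this

theorem toZFSet_mem_hereditary {Θ c : Cardinal.{u}} (h : c < Θ) :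
    c.ord.toZFSet ∈ hereditary Θ :=
  ⟨_, (ZFSet.isOrdinal_toZFSet _).isTransitive, fun _ => id, by simpa using h⟩

/-- The Closed Continuous `∈`-chain Axiom for `κ⁺` yields weakly closed elementary submodels of
size at most `κ` including a given set of size at most `κ`. -/
theorem exists_isWeaklyClosed_subset (hCECA : CECA.{u}) {κ Θ : Cardinal.{u}} (hκ : ℵ₀ ≤ κ)
    (hΘ : Θ.IsRegular) (hκΘ : Order.succ κ < Θ) {B : ZFSet.{u}} (hB : B ∈ hereditary Θ)
    (hBκ : B.card ≤ κ) :
    ∃ M : ZFSet.{u}, IsElementarySubmodel Θ M ∧ IsWeaklyClosed M ∧ M.card ≤ κ ∧ B ⊆ M := by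
  have hreg := isRegular_succ hκ
  -- CECA needs a set of size exactly κ⁺ to be covered, so B is padded.
  let A : ZFSet.{u} := B ∪ (Order.succ κ).ord.toZFSet
  have hAcard : A.card = Order.succ κ := by
    refine le_antisymm (ZFSet.card_union_le.trans ?_) ?_
    · exact add_le_of_le hreg.aleph0_le (hBκ.trans (Order.le_succ κ)) (by simp)
    · calc Order.succ κ = ((Order.succ κ).ord.toZFSet).card := by simp
        _ ≤ A.card := ZFSet.card_mono fun y hy => by simp [A, hy]
  have hAH : A ∈ hereditary Θ := by
    refine mem_hereditary_of_card_lt hΘ (hAcard ▸ hκΘ) fun y hy => ?_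
    rcases ZFSet.mem_union.1 hy with hy | hy
    · exact hereditary_of_mem hy hB
    · exact hereditary_of_mem hy (toZFSet_mem_hereditary hκΘ)
  obtain ⟨M, hM, hMξ, -, hAM⟩ := hCECA (Order.succ κ) (hκ.trans_lt (Order.lt_succ κ)) Θ hΘ hκΘ A ∅
    hAH (hereditary_of_subset (ZFSet.empty_subset B) hB) hAcard (by simp)
  -- As κ⁺ is regular, the chain has length κ⁺, and one stage absorbs all of B.
  obtain ⟨ξ, hξ, hBξ⟩ := hM.exists_subset (Z := B)
    (by
      rw [hreg.cof_ord, hreg.cof_ord]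
      exact Order.lt_succ_of_le hBκ)
    (fun z hz => hAM z (by simp [A, hz]))
  exact ⟨M ξ, (hMξ ξ hξ).1, (hMξ ξ hξ).2.1, Order.le_of_lt_succ (hMξ ξ hξ).2.2, hBξ⟩

end Submodels

theorem ZFSet.exists_subset_card_eq {x : ZFSet.{u}} {c : Cardinal.{u}} (h : c ≤ x.card) :
    ∃ y ⊆ x, y.card = c := by
  let e : Shrink.{u} x → ZFSet.{u} := fun i => (equivShrink x).symm i
  have he : Function.Injective e := Subtype.val_injective.comp (equivShrink x).symm.injective
  obtain ⟨s, hs⟩ := Cardinal.le_mk_iff_exists_set.1 h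
  refine ⟨codeSet e s, fun y hy => ?_, by rw [card_codeSet he, hs]⟩
  obtain ⟨i, -, rfl⟩ := mem_codeSet.1 hy
  exact ((equivShrink x).symm i).2

/-! ### Weakly closed submodels and a coded family. -/

section FamilyCodes

variable {ι X : Type u} {A : ι → Set X} {cX : X → ZFSet.{u}} {cι : ι → ZFSet.{u}}
  {Θ σ τ : Cardinal.{u}} {M Z : ZFSet.{u}}

theorem code_mem_of_mem_iInter (hM : IsElementarySubmodel Θ M) (hΘ : Θ.IsRegular)
    (hcX : Function.Injective cX) (hA : ∀ x α, cX x ∈ cι α ↔ x ∈ A α)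
    (hF : codeSet cX Set.univ ∈ M) (hZ : Z ∈ M) (hZM : Z ⊆ M) {J : Set ι}
    (hJ : codeSet cι J ∈ M) (hJZ : #(⋂ α ∈ J, A α : Set X) ≤ Z.card) {x : X}
    (hx : ∀ α ∈ J, x ∈ A α) : cX x ∈ M := by
  have h := hM.sep_forall_mem_mem hF hJ
  have heq : (codeSet cX Set.univ).sep (fun y => ∀ a ∈ codeSet cι J, y ∈ a) =
      codeSet cX (⋂ α ∈ J, A α) := by
    ext y
    simp only [ZFSet.mem_sep, mem_codeSet, Set.mem_univ, true_and, Set.mem_iInter]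
    constructor
    · rintro ⟨⟨x, rfl⟩, hx⟩
      exact ⟨x, fun α hα => (hA x α).1 (hx _ ⟨α, hα, rfl⟩), rfl⟩
    · rintro ⟨x, hx, rfl⟩
      refine ⟨⟨x, rfl⟩, ?_⟩
      rintro _ ⟨α, hα, rfl⟩
      exact (hA x α).2 (hx α hα)
  rw [heq] at h
  refine hM.subset_of_card_le hΘ hZ hZM h (by rwa [card_codeSet hcX]) ?_
  exact (apply_mem_codeSet hcX).2 (by simpa using hx)

theorem code_mem_of_subset (hM : IsElementarySubmodel Θ M) (hΘ : Θ.IsRegular)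
    (hcι : Function.Injective cι) (hC : codeSet cι Set.univ ∈ M) (hZ : Z ∈ M) (hZM : Z ⊆ M)
    {S : ZFSet.{u}} (hS : S ∈ M) (hSZ : #{α | S ⊆ cι α} ≤ Z.card) {α : ι} (hα : S ⊆ cι α) :
    cι α ∈ M := by
  have h := hM.sep_subset_mem hC hS
  have heq : (codeSet cι Set.univ).sep (fun a => S ⊆ a) = codeSet cι {α | S ⊆ cι α} := by
    ext y
    simp only [ZFSet.mem_sep, mem_codeSet, Set.mem_univ, true_and, Set.mem_ofPred_eq]
    constructor
    · rintro ⟨⟨α, rfl⟩, hα⟩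
      exact ⟨α, hα, rfl⟩
    · rintro ⟨α, hα, rfl⟩
      exact ⟨⟨α, rfl⟩, hα⟩
  rw [heq] at h
  exact hM.subset_of_card_le hΘ hZ hZM h (by rwa [card_codeSet hcι])
    ((apply_mem_codeSet hcι).2 hα)

/-- Weak closure at σ⁺, applied to σ⁺ many of the common points, yields a set all of whose subsets
of size σ are in M. -/
theorem IsWeaklyClosed.exists_subset_code (hM : IsWeaklyClosed M) (hσ : ℵ₀ ≤ σ)
    (hcX : Function.Injective cX) (hA : ∀ x α, cX x ∈ cι α ↔ x ∈ A α) {α : ι}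
    (h : σ < #(A α ∩ {x | cX x ∈ M} : Set X)) :
    ∃ S ∈ M, S ⊆ codeSet cX Set.univ ∧ S.card = σ ∧ S ⊆ cι α := by
  rw [← Order.succ_le_iff, ← card_codeSet hcX] at h
  obtain ⟨I, hI, hIσ⟩ := ZFSet.exists_subset_card_eq h
  have hIM : I ⊆ M := fun y hy => by
    obtain ⟨x, hx, rfl⟩ := mem_codeSet.1 (hI hy)
    exact hx.2
  obtain ⟨J, hJI, hJσ, hJ⟩ := hM _ (isRegular_succ hσ) I hIM hIσ
  obtain ⟨S, hSJ, hSσ⟩ := ZFSet.exists_subset_card_eq (hJσ ▸ Order.le_succ σ)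
  refine ⟨S, hJ S hSJ (hSσ ▸ Order.lt_succ σ), fun y hy => ?_, hSσ, fun y hy => ?_⟩
  · obtain ⟨x, hx, rfl⟩ := mem_codeSet.1 (hI (hJI (hSJ hy)))
    exact mem_codeSet.2 ⟨x, trivial, rfl⟩
  · obtain ⟨x, hx, rfl⟩ := mem_codeSet.1 (hI (hJI (hSJ hy)))
    exact (hA x α).2 hx.1

/-- Weak closure first thins I to τ many indices all of whose small subsets are in M; `hAτ` is
applied only afterwards. -/
theorem IsWeaklyClosed.exists_codeSet_mem (hM : IsWeaklyClosed M) (hτ : τ.IsRegular)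
    (hcι : Function.Injective cι)
    (hAτ : ∀ I : Set ι, #I = τ → ∃ J : Set ι, J ⊆ I ∧ #J < τ ∧ #(⋂ α ∈ J, A α : Set X) ≤ σ)
    {I : Set ι} (hI : #I = τ) (hIM : ∀ α ∈ I, cι α ∈ M) :
    ∃ J ⊆ I, codeSet cι J ∈ M ∧ #(⋂ α ∈ J, A α : Set X) ≤ σ := by
  obtain ⟨K, hKI, hKτ, hK⟩ := hM τ hτ (codeSet cι I) (fun y hy => by
    obtain ⟨α, hα, rfl⟩ := mem_codeSet.1 hy
    exact hIM α hα) (by rw [card_codeSet hcι, hI])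
  have hKu : K ⊆ codeSet cι Set.univ := fun y hy =>
    codeSet_subset_codeSet cι (Set.subset_univ I) (hKI hy)
  obtain ⟨J, hJK, hJτ, hJσ⟩ := hAτ {α | cι α ∈ K} (by rw [mk_setOf_mem hcι hKu, hKτ])
  refine ⟨J, fun α hα => (apply_mem_codeSet hcι).1 (hKI (hJK hα)), hK _ ?_ ?_, hJσ⟩
  · intro y hy
    obtain ⟨α, hα, rfl⟩ := mem_codeSet.1 hy
    exact hJK hα
  · rwa [card_codeSet hcι]

/-- A weakly closed elementary submodel of size at most `κ` that knows about a given family of at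
most `κ` sets. -/
theorem exists_isWeaklyClosed_codes (hCECA : CECA.{u}) {κ : Cardinal.{u}} (hκ : ℵ₀ ≤ κ)
    (hικ : #ι ≤ κ) (hcι : Function.Injective cι) (F : ZFSet.{u}) (hZ : Z.card ≤ κ) :
    ∃ Θ : Cardinal.{u}, Θ.IsRegular ∧ κ < Θ ∧ ∃ M : ZFSet.{u}, IsElementarySubmodel Θ M ∧
      IsWeaklyClosed M ∧ M.card ≤ κ ∧ codeSet cι Set.univ ⊆ M ∧ Z ⊆ M ∧
      F ∈ M ∧ codeSet cι Set.univ ∈ M ∧ Z ∈ M := by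
  let C := codeSet cι Set.univ
  let B : ZFSet.{u} := insert F (insert C (insert Z (C ∪ Z)))
  have hins : ∀ x y : ZFSet.{u}, y.card ≤ κ → (insert x y : ZFSet.{u}).card ≤ κ := fun x y h =>
    ZFSet.card_insert_le.trans (add_le_of_le hκ h (one_le_aleph0.trans hκ))
  have hB : B.card ≤ κ := by
    refine hins _ _ (hins _ _ (hins _ _ (ZFSet.card_union_le.trans (add_le_of_le hκ ?_ hZ))))
    rwa [card_codeSet hcι, mk_univ]
  obtain ⟨Θ, hΘ, hκΘ, hBΘ⟩ := exists_isRegular_mem_hereditary B (Order.succ κ)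
  obtain ⟨M, hM, hMc, hMκ, hBM⟩ := exists_isWeaklyClosed_subset hCECA hκ hΘ hκΘ hBΘ hB
  refine ⟨Θ, hΘ, (Order.lt_succ κ).trans hκΘ, M, hM, hMc, hMκ, fun y hy => hBM ?_,
    fun y hy => hBM ?_, hBM ?_, hBM ?_, hBM ?_⟩
  · simp only [B, ZFSet.mem_insert_iff, ZFSet.mem_union]
    tauto
  all_goals simp [B, C, *]

/-- The theorem for families of at most `σ` sets. -/
theorem exists_isPointLT_of_mk_le (hCECA : CECA.{u}) (hσ : ℵ₀ ≤ σ) (hτ : τ.IsRegular)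
    (hι : #ι ≤ σ)
    (hAτ : ∀ I : Set ι, #I = τ → ∃ J : Set ι, J ⊆ I ∧ #J < τ ∧ #(⋂ α ∈ J, A α : Set X) ≤ σ) :
    ∃ A' : ι → Set X, (∀ α, #(A' α) ≤ σ) ∧ IsPointLT τ (fun α => A α \ A' α) := by
  obtain ⟨cX, cι, hcX, hcι, hA⟩ := exists_coding A
  obtain ⟨Θ, hΘ, -, M, hM, hMc, hMσ, hCM, hZM, hF, hC, hZ⟩ :=
    exists_isWeaklyClosed_codes hCECA hσ hι hcι (codeSet cX Set.univ) (Z := σ.ord.toZFSet)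
      (by simp)
  refine ⟨fun α => A α ∩ {x | cX x ∈ M}, fun α => ?_, fun I hI => ?_⟩
  · exact (mk_le_mk_of_subset Set.inter_subset_right).trans ((mk_setOf_mem_le hcX M).trans hMσ)
  · rw [Set.eq_empty_iff_forall_notMem]
    intro x hx
    simp only [Set.mem_iInter] at hx
    obtain ⟨J, hJI, hJM, hJσ⟩ := hMc.exists_codeSet_mem hτ hcι hAτ hI fun α _ =>
      hCM ((apply_mem_codeSet hcι).2 trivial)
    have hxM : cX x ∈ M := code_mem_of_mem_iInter hM hΘ hcX hA hF hZ hZM hJM (by simpa using hJσ)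
      fun α hα => (hx α (hJI hα)).1
    have hne : #I ≠ 0 := hI ▸ hτ.ne_zero
    obtain ⟨α, hα⟩ := mk_ne_zero_iff.1 hne
    exact (hx α hα).2 ⟨(hx α hα).1, hxM⟩

end FamilyCodes

/-! ### Passing to subfamilies and back. -/

section Restrict

variable {ι ι' X : Type u} {A : ι → Set X} {σ τ : Cardinal.{u}} {f : ι' → ι}

theorem exists_subset_mk_iInter_le_comp (hf : Function.Injective f)
    (hAτ : ∀ I : Set ι, #I = τ → ∃ J : Set ι, J ⊆ I ∧ #J < τ ∧ #(⋂ α ∈ J, A α : Set X) ≤ σ)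
    (I : Set ι') (hI : #I = τ) :
    ∃ J : Set ι', J ⊆ I ∧ #J < τ ∧ #(⋂ α ∈ J, A (f α) : Set X) ≤ σ := by
  obtain ⟨J, hJI, hJτ, hJσ⟩ := hAτ (f '' I) (by rw [mk_image_eq hf, hI])
  obtain ⟨J, hJI', rfl⟩ := Set.subset_image_iff.1 hJI
  rw [mk_image_eq hf] at hJτ
  rw [Set.biInter_image] at hJσ
  exact ⟨J, hJI', hJτ, hJσ⟩

theorem mk_setOf_subset_comp (hf : Function.Injective f) {S : Set X}
    (h : #{α | S ⊆ A α} ≤ σ ∨ #{α | S ⊆ A α} < τ) :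
    #{α | S ⊆ A (f α)} ≤ σ ∨ #{α | S ⊆ A (f α)} < τ := by
  have : #{α | S ⊆ A (f α)} ≤ #{α | S ⊆ A α} := mk_preimage_of_injective f {α | S ⊆ A α} hf
  exact h.imp this.trans this.trans_lt

/-- A solution for a subfamily, extended to the whole index type. -/
theorem exists_extend_of_isPointLT {P : Set ι} {A₁ : P → Set X} (hA₁ : ∀ α, #(A₁ α) ≤ σ)
    (h : IsPointLT τ fun α : P => A α \ A₁ α) :
    ∃ A' : ι → Set X, (∀ α, #(A' α) ≤ σ) ∧ ∀ I ⊆ P, #I = τ → ⋂ α ∈ I, A α \ A' α = ∅ := by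
  classical
  refine ⟨fun α => if hα : α ∈ P then A₁ ⟨α, hα⟩ else ∅, fun α => ?_, fun I hI hIτ => ?_⟩
  · by_cases hα : α ∈ P <;> simp [hα, hA₁]
  · obtain ⟨I, rfl⟩ := Set.subset_range_iff_exists_image_eq.1 (Subtype.range_coe.symm ▸ hI :
      I ⊆ Set.range (Subtype.val : P → ι))
    rw [mk_image_eq Subtype.val_injective] at hIτ
    have := h I hIτ
    rw [Set.biInter_image]
    simpa using this

end Restrict

/-- Some member of the chain has an element that is also a subset of it and has `ρ` elements. -/
theorem IsContinuousMemChain.exists_mem_subset_card_eq {κ ρ : Cardinal.{u}}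
    {M : Ordinal.{u} → ZFSet.{u}} (hM : IsContinuousMemChain κ.ord.cof.ord M) (hρ : ℵ₀ ≤ ρ)
    (hρκ : ρ < κ) (hMc : ∀ ξ < κ.ord.cof.ord, IsWeaklyClosed (M ξ)) {Y Z : ZFSet.{u}}
    (hY : Y.card = κ) (hYM : ∀ y ∈ Y, ∃ ξ < κ.ord.cof.ord, y ∈ M ξ) (hZ : Z.card = ρ)
    (hZM : ∃ ξ < κ.ord.cof.ord, Z ∈ M ξ) (hZM' : ∀ z ∈ Z, ∃ ξ < κ.ord.cof.ord, z ∈ M ξ) :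
    ∃ Z' : ZFSet.{u}, Z'.card = ρ ∧ ∃ ξ < κ.ord.cof.ord, Z' ∈ M ξ ∧ Z' ⊆ M ξ := by
  rcases lt_or_ge ρ κ.ord.cof with hcof | hcof
  · obtain ⟨ξ, hξ, hZξ⟩ := hM.exists_subset (Z := Z) (by rwa [Ordinal.cof_ord_cof, hZ]) hZM'
    obtain ⟨η, hη, hZη⟩ := hZM
    exact ⟨Z, hZ, max ξ η, max_lt hξ hη, hM.mono (le_max_right _ _) (max_lt hξ hη) hZη,
      fun z hz => hM.mono (le_max_left _ _) (max_lt hξ hη) (hZξ hz)⟩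
  -- If all stages had size ≤ ρ, their union would have size ≤ ρ · cf κ = ρ < κ. In a stage of size
  -- > ρ, weak closure at ρ⁺ supplies the set; it replaces Z, which need not fit into one stage by
  -- the cofinality argument.
  · obtain ⟨ξ, hξ, hρξ⟩ : ∃ ξ < κ.ord.cof.ord, ρ < (M ξ).card := by
      by_contra! h
      let e := (Ordinal.ToType.mk (o := κ.ord.cof.ord))
      let f : κ.ord.cof.ord.ToType → ZFSet.{u} := fun i => M (e.symm i).1
      have hYf : Y ⊆ ZFSet.iUnion f := fun y hy => by
        obtain ⟨ξ, hξ, hyξ⟩ := hYM y hy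
        exact ZFSet.mem_iUnion.2 ⟨e ⟨ξ, hξ⟩, by simpa [f] using hyξ⟩
      have h₁ : κ ≤ sum fun i => (f i).card :=
        hY.ge.trans <| (ZFSet.card_mono hYf).trans (ZFSet.card_iUnion_le_sum_card f)
      have h₂ : (sum fun i => (f i).card) ≤ sum fun _ : κ.ord.cof.ord.ToType => ρ :=
        sum_le_sum _ _ fun i => h _ (e.symm i).2
      rw [sum_const', mk_toType, card_ord] at h₂
      exact absurd ((h₁.trans h₂).trans (mul_le_of_le hρ hcof le_rfl)) (not_le.2 hρκ)
    obtain ⟨I, hIξ, hI⟩ := ZFSet.exists_subset_card_eq (Order.succ_le_iff.2 hρξ)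
    obtain ⟨J, hJI, hJ, hJM⟩ := hMc ξ hξ _ (isRegular_succ hρ) I hIξ hI
    obtain ⟨K, hKJ, hK⟩ := ZFSet.exists_subset_card_eq (hJ ▸ Order.le_succ ρ)
    exact ⟨K, hK, ξ, hξ, hJM K hKJ (hK ▸ Order.lt_succ ρ), fun z hz => hIξ (hJI (hKJ hz))⟩

/-! ### Induction on the number of sets. -/

section

variable {ι X : Type u} {σ τ : Cardinal.{u}}

theorem exists_isPointLT_step (hCECA : CECA.{u}) (hσ : σ.IsRegular) (hτ : τ.IsRegular)
    (A : ι → Set X) (hσι : σ < #ι) (hτι : τ ≤ #ι)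
    (hAτ : ∀ I : Set ι, #I = τ → ∃ J : Set ι, J ⊆ I ∧ #J < τ ∧ #(⋂ α ∈ J, A α : Set X) ≤ σ)
    (hAσ : ∀ S : Set X, #S = σ → #{α | S ⊆ A α} ≤ σ ∨ #{α | S ⊆ A α} < τ)
    (ih : ∀ P : Set ι, #P < #ι →
      ∃ A' : P → Set X, (∀ α, #(A' α) ≤ σ) ∧ IsPointLT τ (fun α : P => A α \ A' α)) :
    ∃ A' : ι → Set X, (∀ α, #(A' α) ≤ σ) ∧ IsPointLT τ (fun α => A α \ A' α) := by
  have hι : ℵ₀ ≤ #ι := hσ.aleph0_le.trans hσι.le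
  -- ρ bounds the intersections of size ≤ σ and, if τ < #ι, also the number of sets including a
  -- given S of size σ.
  obtain ⟨ρ, hσρ, hρι, hτρ⟩ : ∃ ρ, σ ≤ ρ ∧ ρ < #ι ∧ (τ < #ι → τ ≤ ρ) := by
    rcases hτι.lt_or_eq with h | h
    · exact ⟨max σ τ, le_max_left _ _, max_lt hσι h, fun _ => le_max_right _ _⟩
    · exact ⟨σ, le_rfl, hσι, fun h' => absurd h h'.ne⟩
  have hρ : ℵ₀ ≤ ρ := hσ.aleph0_le.trans hσρ
  obtain ⟨cX, cι, hcX, hcι, hA⟩ := exists_coding A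
  set F := codeSet cX Set.univ
  obtain ⟨Θ, hΘ, hιΘ, N, hN, hNc, hNι, hCN, hZN, hFN, hCN', hZN'⟩ :=
    exists_isWeaklyClosed_codes hCECA hι le_rfl hcι F (Z := ρ.ord.toZFSet) (by simpa using hρι.le)
  have hCcard : (codeSet cι Set.univ).card = #ι := by rw [card_codeSet hcι, mk_univ]
  -- The chain is made to cover a weakly closed N. Its union is not known to be weakly closed, and N
  -- takes over that role at the top.
  obtain ⟨M, hM, hMξ, -, hNM⟩ := hCECA #ι (hσ.aleph0_le.trans_lt hσι) Θ hΘ hιΘ N ∅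
    (mem_hereditary_of_card_lt hΘ (hNι.trans_lt hιΘ) hN.1)
    (hereditary_of_subset (ZFSet.empty_subset F) (hN.1 F hFN))
    (hNι.antisymm (hCcard ▸ ZFSet.card_mono hCN)) (by simpa using aleph0_pos.trans_le hι)
  set Λ := (#ι).ord.cof.ord
  obtain ⟨Z, hZρ, ξ₁, hξ₁, hZM, hZM'⟩ := hM.exists_mem_subset_card_eq hρ hρι
    (fun ξ hξ => (hMξ ξ hξ).2.1) hCcard (fun y hy => hNM y (hCN hy)) (Z := ρ.ord.toZFSet) (by simp)
    (hNM _ hZN') (fun z hz => hNM z (hZN hz))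
  obtain ⟨ξ₂, hξ₂, hFM⟩ := hNM F hFN
  obtain ⟨ξ₃, hξ₃, hCM⟩ := hNM _ hCN'
  obtain ⟨ξ₀, hξ₀, h₁, h₂, h₃⟩ : ∃ ξ₀ < Λ, ξ₁ ≤ ξ₀ ∧ ξ₂ ≤ ξ₀ ∧ ξ₃ ≤ ξ₀ :=
    ⟨max ξ₁ (max ξ₂ ξ₃), max_lt hξ₁ (max_lt hξ₂ hξ₃), by simp, by simp, by simp⟩
  -- The chain is held constant up to ξ₀, so that every stage contains the parameters F, Z and the
  -- set of codes of the family.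
  let K : Ordinal.{u} → ZFSet.{u} := fun ξ => M (max ξ₀ ξ)
  have hKlt : ∀ ξ < Λ, max ξ₀ ξ < Λ := fun ξ hξ => max_lt hξ₀ hξ
  have hKmono : ∀ ξ η, ξ ≤ η → η < Λ → K ξ ⊆ K η := fun ξ η h hη =>
    hM.mono (max_le_max_left _ h) (hKlt η hη)
  have hKel : ∀ ξ < Λ, IsElementarySubmodel Θ (K ξ) := fun ξ hξ => (hMξ _ (hKlt ξ hξ)).1
  have hKwc : ∀ ξ < Λ, IsWeaklyClosed (K ξ) := fun ξ hξ => (hMξ _ (hKlt ξ hξ)).2.1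
  have hKcard : ∀ ξ < Λ, (K ξ).card < #ι := fun ξ hξ => (hMξ _ (hKlt ξ hξ)).2.2
  have hKF : ∀ ξ < Λ, F ∈ K ξ := fun ξ hξ =>
    hM.mono (h₂.trans (le_max_left _ _)) (hKlt ξ hξ) hFM
  have hKC : ∀ ξ < Λ, codeSet cι Set.univ ∈ K ξ := fun ξ hξ =>
    hM.mono (h₃.trans (le_max_left _ _)) (hKlt ξ hξ) hCM
  have hKZ : ∀ ξ < Λ, Z ∈ K ξ := fun ξ hξ =>
    hM.mono (h₁.trans (le_max_left _ _)) (hKlt ξ hξ) hZM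
  have hKZ' : ∀ ξ < Λ, Z ⊆ K ξ := fun ξ hξ z hz =>
    hM.mono (h₁.trans (le_max_left _ _)) (hKlt ξ hξ) (hZM' hz)
  have hKlim : ∀ δ < Λ, Order.IsSuccLimit δ → ∀ y ∈ K δ, ∃ η < δ, y ∈ K η := by
    intro δ hδ hδl y hy
    rcases le_or_gt δ ξ₀ with h | h
    · refine ⟨0, hδl.bot_lt, ?_⟩
      simpa [K, h] using hy
    · obtain ⟨η, hη, hyη⟩ := (hM.continuous δ hδ hδl y).1 (by simpa [K, h.le] using hy)
      exact ⟨η, hη, hM.mono (le_max_right _ _) (hKlt η (hη.trans hδ)) hyη⟩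
  have hNK : ∀ y ∈ N, ∃ ξ < Λ, y ∈ K ξ := fun y hy => by
    obtain ⟨ξ, hξ, h⟩ := hNM y hy
    exact ⟨ξ, hξ, hM.mono (le_max_right _ _) (hKlt ξ hξ) h⟩
  have hQK : ∀ ξ < Λ, ∀ J : Set ι, codeSet cι J ∈ K ξ → #(⋂ α ∈ J, A α : Set X) ≤ σ →
      ∀ x, (∀ α ∈ J, x ∈ A α) → cX x ∈ K ξ := fun ξ hξ J hJ hJσ x hx =>
    code_mem_of_mem_iInter (hKel ξ hξ) hΘ hcX hA (hKF ξ hξ) (hKZ ξ hξ) (hKZ' ξ hξ) hJ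
      (hJσ.trans (hZρ ▸ hσρ)) hx
  have hS : ∀ S : ZFSet.{u}, S ⊆ F → S.card = σ →
      #{α | S ⊆ cι α} ≤ σ ∨ #{α | S ⊆ cι α} < τ := by
    intro S hSF hSσ
    have h := hAσ {x | cX x ∈ S} (by rw [mk_setOf_mem hcX hSF, hSσ])
    have heq : {α | S ⊆ cι α} = {α | {x | cX x ∈ S} ⊆ A α} := by
      ext α
      refine ⟨fun h x hx => (hA x α).1 (h hx), fun h y hy => ?_⟩
      obtain ⟨x, -, rfl⟩ := mem_codeSet.1 (hSF hy)
      exact (hA x α).2 (h hy)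
    rwa [heq]
  -- The second alternative forces `hsmall`. If τ < #ι it adds nothing, by `hPK`.
  let P : Ordinal.{u} → Set ι := fun ξ =>
    {α | cι α ∈ K ξ ∨ ∃ S ∈ K ξ, S ⊆ F ∧ S.card = σ ∧ S ⊆ cι α}
  have hPmono : ∀ ξ η, ξ ≤ η → η < Λ → P ξ ⊆ P η := by
    rintro ξ η h hη α (hα | ⟨S, hS, hS'⟩)
    · exact Or.inl (hKmono ξ η h hη hα)
    · exact Or.inr ⟨S, hKmono ξ η h hη hS, hS'⟩
  have hPK : τ < #ι → ∀ ξ < Λ, ∀ α ∈ P ξ, cι α ∈ K ξ := by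
    rintro h ξ hξ α (hα | ⟨S, hSK, hSF, hSσ, hSα⟩)
    · exact hα
    · refine code_mem_of_subset (hKel ξ hξ) hΘ hcι (hKC ξ hξ) (hKZ ξ hξ) (hKZ' ξ hξ) hSK ?_ hSα
      rw [hZρ]
      exact (hS S hSF hSσ).elim (fun h => h.trans hσρ) (fun h' => h'.le.trans (hτρ h))
  have hPcard : ∀ ξ < Λ, #(P ξ) < #ι := by
    intro ξ hξ
    rcases hτι.lt_or_eq with h | h
    · refine ((mk_le_mk_of_subset fun α hα => ?_).trans (mk_setOf_mem_le hcι (K ξ))).trans_lt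
        (hKcard ξ hξ)
      exact hPK h ξ hξ α hα
    -- Here τ = #ι is regular: fewer than τ sets S, each included in fewer than τ members.
    · let e : Shrink.{u} (K ξ) → ZFSet.{u} := fun i => (equivShrink (K ξ)).symm i
      let D : Shrink.{u} (K ξ) → Set ι := fun i => {α | e i ⊆ F ∧ (e i).card = σ ∧ e i ⊆ cι α}
      have hD : ∀ i, #(D i) < τ := by
        intro i
        by_cases hi : e i ⊆ F ∧ (e i).card = σ
        · refine (mk_le_mk_of_subset (t := {α | e i ⊆ cι α}) fun α hα => hα.2.2).trans_lt ?_
          exact (hS _ hi.1 hi.2).elim (fun h' => h'.trans_lt (h ▸ hσι)) id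
        · have : D i = ∅ := Set.eq_empty_of_forall_notMem fun α hα => hi ⟨hα.1, hα.2.1⟩
          simpa [this] using hτ.pos
      have hPsub : P ξ ⊆ {α | cι α ∈ K ξ} ∪ ⋃ i, D i := by
        rintro α (hα | ⟨S, hSK, hS⟩)
        · exact Or.inl hα
        · refine Or.inr (Set.mem_iUnion.2 ⟨equivShrink (K ξ) ⟨S, hSK⟩, ?_⟩)
          simpa [D, e] using hS
      refine ((mk_le_mk_of_subset hPsub).trans (mk_union_le _ _)).trans_lt ?_
      refine add_lt_of_lt hι ((mk_setOf_mem_le hcι (K ξ)).trans_lt (hKcard ξ hξ)) ?_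
      rw [← h]
      exact (mk_iUnion_le_sum_mk).trans_lt (sum_lt_of_isRegular hτ (h ▸ hKcard ξ hξ) hD)
  refine exists_isPointLT_of_filtration hτ.aleph0_le A (Λ := Λ) P (fun ξ => {x | cX x ∈ K ξ})
    (fun ξ η h hη x hx => hKmono ξ η h hη hx) ?_ ?_ ?_ ?_ ?_ hσ.aleph0_le
  · intro α
    obtain ⟨ξ, hξ, h⟩ := hNK (cι α) (hCN ((apply_mem_codeSet hcι).2 trivial))
    exact ⟨ξ, hξ, Or.inl h⟩
  · rintro δ hδ hδl α (hα | ⟨S, hS, hS'⟩)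
    · obtain ⟨η, hη, h⟩ := hKlim δ hδ hδl _ hα
      exact ⟨η, hη, Or.inl h⟩
    · obtain ⟨η, hη, h⟩ := hKlim δ hδ hδl _ hS
      exact ⟨η, hη, Or.inr ⟨S, h, hS'⟩⟩
  · intro ξ hξ
    obtain ⟨A₁, hA₁, h⟩ := ih (P ξ) (hPcard ξ hξ)
    exact exists_extend_of_isPointLT hA₁ h
  · intro ξ hξ α hα
    by_contra! h
    exact hα (Or.inr ((hKwc ξ hξ).exists_subset_code hσ.aleph0_le hcX hA h))
  · intro δ hδ hδl I hI hIτ x hx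
    rcases hδ.lt_or_eq with hδ | rfl
    · rcases hτι.lt_or_eq with h | h
      · obtain ⟨J, hJI, hJ, hJσ⟩ := (hKwc δ hδ).exists_codeSet_mem hτ hcι hAτ hIτ fun α hα => by
          obtain ⟨η, hη, hαη⟩ := hI hα
          exact hPK h δ hδ α (hPmono η δ hη.le hδ hαη)
        obtain ⟨η, hη, hJη⟩ := hKlim δ hδ hδl _ hJ
        exact ⟨η, hη, hQK η (hη.trans hδ) J hJη hJσ x fun α hα => hx α (hJI hα)⟩
      -- If τ = #ι, no stage before the top captures τ many indices.
      · refine absurd (hPcard δ hδ) (not_lt.2 ?_)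
        rw [← h, ← hIτ]
        refine mk_le_mk_of_subset fun α hα => ?_
        obtain ⟨η, hη, hαη⟩ := hI hα
        exact hPmono η δ hη.le hδ hαη
    · obtain ⟨J, hJI, hJ, hJσ⟩ := hNc.exists_codeSet_mem hτ hcι hAτ hIτ fun α _ =>
        hCN ((apply_mem_codeSet hcι).2 trivial)
      obtain ⟨η, hη, hJη⟩ := hNK _ hJ
      exact ⟨η, hη, hQK η hη J hJη hJσ x fun α hα => hx α (hJI hα)⟩

/-- The disjunction in the second hypothesis accommodates both conditions of the theorem and is
inherited by subfamilies. -/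
theorem exists_isPointLT (hCECA : CECA.{u}) (hσ : σ.IsRegular) (hτ : τ.IsRegular)
    (κ : Cardinal.{u}) : ∀ (ι : Type u) (A : ι → Set X), #ι = κ →
    (∀ I : Set ι, #I = τ → ∃ J : Set ι, J ⊆ I ∧ #J < τ ∧ #(⋂ α ∈ J, A α : Set X) ≤ σ) →
    (∀ S : Set X, #S = σ → #{α | S ⊆ A α} ≤ σ ∨ #{α | S ⊆ A α} < τ) →
    ∃ A' : ι → Set X, (∀ α, #(A' α) ≤ σ) ∧ IsPointLT τ (fun α => A α \ A' α) := by
  induction κ using WellFoundedLT.induction with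
  | ind κ ih =>
    intro ι A hι hAτ hAσ
    rcases le_or_gt #ι σ with h | h
    · exact exists_isPointLT_of_mk_le hCECA hσ.aleph0_le hτ h hAτ
    rcases lt_or_ge #ι τ with h' | h'
    · exact ⟨fun _ => ∅, by simp, fun I hI => absurd (mk_set_le I) (not_le.2 (hI ▸ h'))⟩
    · refine exists_isPointLT_step hCECA hσ hτ A h h' hAτ hAσ fun P hP => ?_
      exact ih #P (hι ▸ hP) P (fun α => A α) rfl
        (exists_subset_mk_iInter_le_comp Subtype.val_injective hAτ)
        fun S hS => mk_setOf_subset_comp Subtype.val_injective (hAσ S hS)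

end

theorem theorem2p1 (hCECA : CECA.{u}) (σ τ : Cardinal.{u}) (hσ : σ.IsRegular) (hτ : τ.IsRegular)
    (ι X : Type u) (A : ι → Set X)
    (hA :
      (∀ I : Set ι, #I = τ → ∃ J : Set ι, J ⊆ I ∧ #J < τ ∧ #(⋂ α ∈ J, A α : Set X) < σ) ∨
      ((∀ I : Set ι, #I = τ → ∃ J : Set ι, J ⊆ I ∧ #J < τ ∧ #(⋂ α ∈ J, A α : Set X) ≤ σ) ∧
        ∀ S : Set X, S ⊆ ⋃ α, A α → #S = σ → #{α : ι | S ⊆ A α} ≤ σ)) :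
    ∃ A' : ι → Set X, (∀ α, #(A' α) ≤ σ) ∧ IsPointLT τ (fun α => A α \ A' α) := by
  rcases hA with hA | ⟨hAτ, hAσ⟩
  · refine exists_isPointLT hCECA hσ hτ #ι ι A rfl (fun I hI => ?_) fun S hS => Or.inr ?_
    · obtain ⟨J, hJI, hJ, hJσ⟩ := hA I hI
      exact ⟨J, hJI, hJ, hJσ.le⟩
    -- If τ many members included S, every intersection of some of them would have size ≥ σ.
    · by_contra! h
      obtain ⟨I, hI, hIτ⟩ := le_mk_iff_exists_subset.1 h
      obtain ⟨J, hJI, -, hJσ⟩ := hA I hIτ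
      refine absurd hJσ (not_lt.2 (hS ▸ mk_le_mk_of_subset ?_))
      exact Set.subset_iInter₂ fun α hα => hI (hJI hα)
  · refine exists_isPointLT hCECA hσ hτ #ι ι A rfl hAτ fun S hS => Or.inl ?_
    rcases Set.eq_empty_or_nonempty {α | S ⊆ A α} with h | ⟨α, hα⟩
    · simp [h]
    · exact hAσ S (hα.trans (Set.subset_iUnion A α)) hS
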